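/- Let $n\ge 0$ and let $\mu$ be a probability measure on $\mathbb{R}^n$. Assume: - $\mu$ is log-concave, i.e. it has a density $g\ge 0$ with respect to Lebesgue measure with $g(\tau x+(1-\tau)y)\ge g(x)^{\tau}g(y)^{1-\tau}$ for all $x,y\in\mathbb{R}^n$ and $\tau\in[0,1]$; - $\mu$ is isotropic, i.e. its barycenter is the origin and its covariance matrix is the identity; - $\mu$ has a continuous density $f:\mathbb{R}^n\to[0,\infty)$ which is $1$-unconditional, i.e. $f(\epsilon_1x_1,\ldots,\epsilon_nx_n)=f(x_1,\ldots,x_n)$ for all $x\in\mathbb{R}^n$ and all signs $\epsilon_i\in\{-1,1\}$. Let $B_2^n$ be the closed Euclidean unit ball and, for $A\subseteq\mathbb{R}^n$, put $$\mu^+(\partial A)=\liminf_{\epsilon\to0^+}\frac{\mu\big((A+\epsilon B_2^n)\setminus A\big)}{\epsilon},\qquad \Gamma(\mu)=\sup\{\mu^+(\partial A): A\subset\mathbb{R}^n\text{ compact and convex with nonempty interior}\}.$$ Then for every convex set $A\subseteq\mathbb{R}^n$ and every $\epsilon>0$, $$\mu\big((A+\epsilon B_2^n)\setminus A\big)\le\sqrt2\,n\,\epsilon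 .$$ Consequently $\mu^+(\partial A)\le\sqrt2\,n$ for every convex set $A\subseteq\mathbb{R}^n$, and hence $\Gamma(\mu)\le\sqrt2\,n$. -/

import Mathlib

open MeasureTheory ProbabilityTheory Filter Topology
open scoped Pointwise ENNReal

namespace MaxPerimeter

/-- `f` is a density of `μ` with respect to Lebesgue measure on `ℝⁿ`. -/
structure IsDensity {n : ℕ} (μ : Measure (EuclideanSpace ℝ (Fin n)))
    (f : EuclideanSpace ℝ (Fin n) → ℝ) : Prop where
  nonneg : ∀ x, 0 ≤ f x
  aemeasurable : AEMeasurable f volume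
  eq_withDensity : μ = volume.withDensity (fun x => ENNReal.ofReal (f x))

/-- Log-concavity of a nonnegative function, in multiplicative form so that zeros of `f`
(where `ln f = -∞`) are treated correctly. -/
def LogConcaveFun {n : ℕ} (f : EuclideanSpace ℝ (Fin n) → ℝ) : Prop :=
  ∀ x y : EuclideanSpace ℝ (Fin n), ∀ τ ∈ Set.Icc (0 : ℝ) 1,
    f x ^ τ * f y ^ (1 - τ) ≤ f (τ • x + (1 - τ) • y)

/-- A measure on `ℝⁿ` is log-concave if it admits a log-concave density. -/
def IsLogConcave {n : ℕ} (μ : Measure (EuclideanSpace ℝ (Fin n))) : Prop :=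
  ∃ g : EuclideanSpace ℝ (Fin n) → ℝ, IsDensity μ g ∧ LogConcaveFun g

/-- The barycenter is the origin and the covariance matrix is the identity. (The diagonal entries
being `1` forces the second moments to be finite, so none of these integrals is a junk value.) -/
structure IsIsotropic {n : ℕ} (μ : Measure (EuclideanSpace ℝ (Fin n))) : Prop where
  barycenter_eq_zero : ∫ x, x ∂μ = 0
  covariance_eq_one :
    (Matrix.of fun i j : Fin n => cov[fun x => x i, fun x => x j; μ]) = 1

/-- Invariance under all changes of signs of the coordinates. -/
def IsUnconditional {n : ℕ} (f : EuclideanSpace ℝ (Fin n) → ℝ) : Prop :=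
  ∀ s : Fin n → ℝ, (∀ i, s i = 1 ∨ s i = -1) →
    ∀ x : EuclideanSpace ℝ (Fin n), f (WithLp.toLp 2 fun i => s i * x i) = f x

/-- The layer `(A + ε B₂ⁿ) \ A`, where `B₂ⁿ` is the closed Euclidean unit ball. -/
def outerLayer {n : ℕ} (A : Set (EuclideanSpace ℝ (Fin n))) (ε : ℝ) :
    Set (EuclideanSpace ℝ (Fin n)) :=
  (A + ε • Metric.closedBall (0 : EuclideanSpace ℝ (Fin n)) 1) \ A

/-- The `μ`-perimeter `μ⁺(∂A)`, with values in `[0, ∞]`. -/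
noncomputable def perimeter {n : ℕ} (μ : Measure (EuclideanSpace ℝ (Fin n)))
    (A : Set (EuclideanSpace ℝ (Fin n))) : ℝ≥0∞ :=
  liminf (fun ε : ℝ => μ (outerLayer A ε) / ENNReal.ofReal ε) (𝓝[>] 0)

/-- A convex body: a compact convex set with nonempty interior. -/
structure IsConvexBody {n : ℕ} (A : Set (EuclideanSpace ℝ (Fin n))) : Prop where
  convex : Convex ℝ A
  isCompact : IsCompact A
  interior_nonempty : (interior A).Nonempty

/-- The maximal perimeter constant `Γ(μ)`, with values in `[0, ∞]`. -/
noncomputable def maximalPerimeter {n : ℕ} (μ : Measure (EuclideanSpace ℝ (Fin n))) : ℝ≥0∞ :=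
  ⨆ (A : Set (EuclideanSpace ℝ (Fin n))) (_ : IsConvexBody A), perimeter μ A

end MaxPerimeter

namespace MaxPerimeter

/-! The ball `ε B₂ⁿ` lies in the cube `[-ε, ε]ⁿ`, which is the Minkowski sum of `n` axis segments.
Adding the segments one at a time keeps the set convex, so it suffices that each addition gains mass
at most `√2 ε` (`measure_add_sum_sdiff_le`).

On a line parallel to the `i`-th axis a convex set is an interval, and its layer has length at most
`2ε`. Evenness and log-concavity make the density largest on that line where `x i = 0`. By Fubini
the gain is at most `2ε` times the mass of the central section
(`withDensity_add_axisSegment_sdiff_le`).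

That mass is `G 0`, where `G` is the marginal density of `x i`: even, log-concave by
Prékopa–Leindler, of mass one and second moment at least one. Comparison with the Laplace density of
the same height at the origin gives `G 0 ≤ 1 / √2` (`two_mul_sq_le_one_of_even`,
`lintegral_section_le`), and `2ε / √2 = √2 ε`. -/

/-! ### Brunn–Minkowski on the line -/

/-- One-dimensional Brunn–Minkowski inequality for compact sets. -/
lemma volume_add_le_of_isCompact {K L : Set ℝ} (hK : IsCompact K) (hL : IsCompact L)
    (hK' : K.Nonempty) (hL' : L.Nonempty) : volume K + volume L ≤ volume (K + L) := by
  obtain ⟨a, haK, ha⟩ := hK.exists_isGreatest hK'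
  obtain ⟨b, hbL, hb⟩ := hL.exists_isLeast hL'
  -- With `a = max K` and `b = min L`, the two translates meet at most in the point `a + b`.
  have hsub : ((b + ·) '' K) ∪ ((a + ·) '' L) ⊆ K + L := by
    rintro _ (⟨x, hx, rfl⟩ | ⟨x, hx, rfl⟩)
    · exact ⟨x, hx, b, hbL, add_comm _ _⟩
    · exact ⟨a, haK, x, hx, rfl⟩
  have hdisj : AEDisjoint volume ((b + ·) '' K) ((a + ·) '' L) := by
    refine measure_mono_null (t := {a + b}) ?_ (by simp)
    rintro _ ⟨⟨x, hx, rfl⟩, y, hy, hxy⟩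
    have h1 := ha hx
    have h2 := hb hy
    simp only [Set.mem_singleton_iff] at hxy ⊢
    linarith
  have hLm : MeasurableSet ((a + ·) '' L) :=
    (hL.image (by fun_prop)).isClosed.measurableSet
  calc volume K + volume L
      = volume ((b + ·) '' K) + volume ((a + ·) '' L) := by
        simp only [Set.image_add_left, measure_preimage_add]
    _ = volume (((b + ·) '' K) ∪ ((a + ·) '' L)) :=
        (measure_union₀ hLm.nullMeasurableSet hdisj).symm
    _ ≤ volume (K + L) := measure_mono hsub

/-- One-dimensional Brunn–Minkowski inequality for measurable sets. -/
lemma volume_add_le_of_measurableSet {A B : Set ℝ} (hA : MeasurableSet A) (hB : MeasurableSet B)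
    (hA' : A.Nonempty) (hB' : B.Nonempty) : volume A + volume B ≤ volume (A + B) := by
  obtain ⟨a, ha⟩ := hA'
  obtain ⟨b, hb⟩ := hB'
  have hsup : ∀ {S : Set ℝ}, MeasurableSet S →
      volume S = ⨆ K : {K : Set ℝ // K ⊆ S ∧ IsCompact K}, volume K.1 := fun hS => by
    rw [hS.measure_eq_iSup_isCompact, iSup_subtype]
    simp only [iSup_and]
  have : Nonempty {K : Set ℝ // K ⊆ A ∧ IsCompact K} := ⟨∅, by simp⟩
  have : Nonempty {K : Set ℝ // K ⊆ B ∧ IsCompact K} := ⟨∅, by simp⟩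
  rw [hsup hA, hsup hB]
  refine ENNReal.iSup_add_iSup_le fun K L => ?_
  -- The compact subsets may be empty; inserting `a` and `b` makes them nonempty.
  calc volume K.1 + volume L.1 ≤ volume (insert a K.1) + volume (insert b L.1) := by
        gcongr <;> exact Set.subset_insert _ _
    _ ≤ volume (insert a K.1 + insert b L.1) :=
        volume_add_le_of_isCompact (K.2.2.insert a) (L.2.2.insert b) (Set.insert_nonempty _ _)
          (Set.insert_nonempty _ _)
    _ ≤ volume (A + B) := measure_mono
        (Set.add_subset_add (Set.insert_subset ha K.2.1) (Set.insert_subset hb L.2.1))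

/-! ### Prékopa–Leindler, from the line to `ℝᵐ` -/

/-- The Prékopa–Leindler inequality on a measure space with a real vector space structure. -/
def PrekopaLeindler (E : Type*) [AddCommGroup E] [Module ℝ E] [MeasureSpace E] : Prop :=
  ∀ t ∈ Set.Ioo (0 : ℝ) 1, ∀ f g h : E → ℝ≥0∞, Measurable f → Measurable g → Measurable h →
    (∀ x y, f x ^ (1 - t) * g y ^ t ≤ h ((1 - t) • x + t • y)) →
    (∫⁻ x, f x) ^ (1 - t) * (∫⁻ x, g x) ^ t ≤ ∫⁻ x, h x

/-- Tensorization: the inequality in `F` says that the fibre integrals satisfy the hypothesis of the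
inequality in `E`. -/
lemma PrekopaLeindler.prod {E F : Type*} [AddCommGroup E] [Module ℝ E] [MeasureSpace E]
    [AddCommGroup F] [Module ℝ F] [MeasureSpace F] [SFinite (volume : Measure F)]
    (hE : PrekopaLeindler E) (hF : PrekopaLeindler F) : PrekopaLeindler (E × F) := by
  intro t ht f g h hf hg hh H
  rw [Measure.volume_eq_prod, lintegral_prod _ hf.aemeasurable,
    lintegral_prod _ hg.aemeasurable, lintegral_prod _ hh.aemeasurable]
  refine hE t ht _ _ _ hf.lintegral_prod_right' hg.lintegral_prod_right' hh.lintegral_prod_right'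
    fun x y => ?_
  refine hF t ht _ _ _ (by fun_prop) (by fun_prop) (by fun_prop) fun u v => ?_
  exact H (x, u) (y, v)

lemma PrekopaLeindler.of_linearEquiv {E F : Type*} [AddCommGroup E] [Module ℝ E] [MeasureSpace E]
    [AddCommGroup F] [Module ℝ F] [MeasureSpace F]
    (hE : PrekopaLeindler E) (e : E ≃ₗ[ℝ] F) (he : MeasurePreserving e) :
    PrekopaLeindler F := by
  intro t ht f g h hf hg hh H
  rw [← he.lintegral_comp hf, ← he.lintegral_comp hg, ← he.lintegral_comp hh]
  refine hE t ht _ _ _ (hf.comp he.measurable) (hg.comp he.measurable) (hh.comp he.measurable)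
    fun x y => ?_
  simpa using H (e x) (e y)

lemma lintegral_eq_of_le_one {f : ℝ → ℝ≥0∞} (hf : Measurable f) (h1 : ∀ x, f x ≤ 1) :
    ∫⁻ x, f x = ∫⁻ r in Set.Ioo (0 : ℝ) 1, volume {x | ENNReal.ofReal r < f x} := by
  have h := lintegral_eq_lintegral_meas_lt volume (f := fun x => (f x).toReal)
    (Eventually.of_forall fun x => ENNReal.toReal_nonneg) hf.ennreal_toReal.aemeasurable
  have hfin : ∀ x, f x ≠ ∞ := fun x => ((h1 x).trans_lt ENNReal.one_lt_top).ne
  simp only [ENNReal.ofReal_toReal (hfin _)] at h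
  rw [h, ← Set.Ioo_union_Ici_eq_Ioi (zero_lt_one (α := ℝ)),
    lintegral_union measurableSet_Ici (by
      rw [Set.disjoint_left]; intro x hx hx'; exact absurd hx.2 (not_lt.2 hx'))]
  have h0 : ∫⁻ r in Set.Ici (1 : ℝ), volume {x | r < (f x).toReal} = 0 := by
    rw [setLIntegral_congr_fun (g := 0) measurableSet_Ici]
    · simp
    · intro r hr
      have : {x | r < (f x).toReal} = ∅ := by
        ext x
        simp only [Set.mem_ofPred_eq, Set.mem_empty_iff_false, iff_false, not_lt]
        exact (ENNReal.toReal_mono (by simp) (h1 x)).trans (by simpa using hr)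
      simp [this]
  rw [h0, add_zero]
  refine setLIntegral_congr_fun measurableSet_Ioo fun r hr => ?_
  simp only [ENNReal.ofReal_lt_iff_lt_toReal hr.1.le (hfin _)]

/-- Since both suprema are `1`, the superlevel sets of `f` and `g` at each level `r < 1` are
nonempty and Brunn–Minkowski applies to them. Integrating over `r` gives a bound with the arithmetic
mean, which dominates the geometric one. -/
lemma prekopaLeindler_real_of_iSup_eq_one {t : ℝ} (ht : t ∈ Set.Ioo (0 : ℝ) 1)
    {f g h : ℝ → ℝ≥0∞} (hf : Measurable f) (hg : Measurable g) (hh : Measurable h)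
    (hf1 : ⨆ x, f x = 1) (hg1 : ⨆ x, g x = 1)
    (H : ∀ x y, f x ^ (1 - t) * g y ^ t ≤ h ((1 - t) • x + t • y)) :
    (∫⁻ x, f x) ^ (1 - t) * (∫⁻ x, g x) ^ t ≤ ∫⁻ x, h x := by
  have ht' : 0 < 1 - t := by linarith [ht.2]
  have hfle : ∀ x, f x ≤ 1 := fun x => (le_iSup f x).trans hf1.le
  have hgle : ∀ x, g x ≤ 1 := fun x => (le_iSup g x).trans hg1.le
  have key : ENNReal.ofReal (1 - t) * (∫⁻ x, f x) + ENNReal.ofReal t * ∫⁻ x, g x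
      ≤ ∫⁻ x, min (h x) 1 := by
    rw [lintegral_eq_of_le_one hf hfle, lintegral_eq_of_le_one hg hgle,
      lintegral_eq_of_le_one (hh.min measurable_const) (fun x => min_le_right _ _),
      ← lintegral_const_mul' _ _ ENNReal.ofReal_ne_top,
      ← lintegral_const_mul' _ _ ENNReal.ofReal_ne_top,
      ← lintegral_add_left']
    swap
    · refine (Antitone.measurable (fun a b hab => ?_)).const_mul _ |>.aemeasurable
      exact measure_mono fun x hx => (ENNReal.ofReal_le_ofReal hab).trans_lt hx
    refine setLIntegral_mono' measurableSet_Ioo fun r hr => ?_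
    have hr1 : ENNReal.ofReal r < 1 := by simpa using hr.2
    obtain ⟨x, hx⟩ := lt_iSup_iff.1 (hf1.symm ▸ hr1)
    obtain ⟨y, hy⟩ := lt_iSup_iff.1 (hg1.symm ▸ hr1)
    have hmf : MeasurableSet {x | ENNReal.ofReal r < f x} := measurableSet_lt measurable_const hf
    have hmg : MeasurableSet {x | ENNReal.ofReal r < g x} := measurableSet_lt measurable_const hg
    have hBM := volume_add_le_of_measurableSet (hmf.const_smul₀ (1 - t)) (hmg.const_smul₀ t)
      (Set.Nonempty.smul_set ⟨x, hx⟩) (Set.Nonempty.smul_set ⟨y, hy⟩)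
    rw [Measure.addHaar_smul, Measure.addHaar_smul, Module.finrank_self, pow_one, pow_one,
      abs_of_pos ht', abs_of_pos ht.1] at hBM
    refine hBM.trans (measure_mono ?_)
    rintro _ ⟨_, ⟨u, hu, rfl⟩, _, ⟨v, hv, rfl⟩, rfl⟩
    refine lt_min (lt_of_lt_of_le ?_ (H u v)) hr1
    have hr0 : ENNReal.ofReal r ≠ 0 := by simpa using hr.1
    calc ENNReal.ofReal r = ENNReal.ofReal r ^ (1 - t) * ENNReal.ofReal r ^ t := by
          rw [← ENNReal.rpow_add _ _ hr0 ENNReal.ofReal_ne_top]; simp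
      _ < f u ^ (1 - t) * g v ^ t :=
          ENNReal.mul_lt_mul (ENNReal.rpow_lt_rpow hu ht') (ENNReal.rpow_lt_rpow hv ht.1)
  calc (∫⁻ x, f x) ^ (1 - t) * (∫⁻ x, g x) ^ t
      ≤ ENNReal.ofReal (1 - t) * (∫⁻ x, f x) + ENNReal.ofReal t * ∫⁻ x, g x := by
        by_cases hF : ∫⁻ x, f x = ∞
        · rw [hF, ENNReal.mul_top (by simpa using ht.2), top_add]
          exact le_top
        by_cases hG : ∫⁻ x, g x = ∞
        · rw [hG, ENNReal.mul_top (by simpa using ht.1), add_top]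
          exact le_top
        lift (∫⁻ x, f x) to NNReal using hF with F
        lift (∫⁻ x, g x) to NNReal using hG with G
        have := NNReal.geom_mean_le_arith_mean2_weighted (1 - t).toNNReal t.toNNReal F G
          (by rw [← Real.toNNReal_add ht'.le ht.1.le]; simp)
        rw [Real.coe_toNNReal _ ht'.le, Real.coe_toNNReal _ ht.1.le] at this
        rw [ENNReal.ofReal, ENNReal.ofReal, ← ENNReal.coe_rpow_of_nonneg _ ht'.le, ← ENNReal.coe_rpow_of_nonneg _ ht.1.le]
        exact_mod_cast this
    _ ≤ ∫⁻ x, min (h x) 1 := key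
    _ ≤ ∫⁻ x, h x := lintegral_mono fun x => min_le_left _ _

/-- Both sides are homogeneous, so `f` and `g` can be scaled to have supremum `1`. -/
lemma prekopaLeindler_real_of_iSup_ne_top {t : ℝ} (ht : t ∈ Set.Ioo (0 : ℝ) 1)
    {f g h : ℝ → ℝ≥0∞} (hf : Measurable f) (hg : Measurable g) (hh : Measurable h)
    (hf1 : ⨆ x, f x ≠ ∞) (hg1 : ⨆ x, g x ≠ ∞)
    (H : ∀ x y, f x ^ (1 - t) * g y ^ t ≤ h ((1 - t) • x + t • y)) :
    (∫⁻ x, f x) ^ (1 - t) * (∫⁻ x, g x) ^ t ≤ ∫⁻ x, h x := by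
  have ht' : 0 < 1 - t := by linarith [ht.2]
  set a := ⨆ x, f x with ha
  set b := ⨆ x, g x with hb
  rcases eq_or_ne a 0 with ha0 | ha0
  · have : ∀ x, f x = 0 := fun x => le_antisymm ((le_iSup f x).trans ha0.le) zero_le
    simp [this, ENNReal.zero_rpow_of_pos ht']
  rcases eq_or_ne b 0 with hb0 | hb0
  · have : ∀ x, g x = 0 := fun x => le_antisymm ((le_iSup g x).trans hb0.le) zero_le
    simp [this, ENNReal.zero_rpow_of_pos ht.1]
  have hane : a⁻¹ ≠ ∞ := by simpa using ha0
  have hbne : b⁻¹ ≠ ∞ := by simpa using hb0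
  set c := a⁻¹ ^ (1 - t) * b⁻¹ ^ t with hc
  have hcne : c ≠ ∞ := ENNReal.mul_ne_top (ENNReal.rpow_ne_top_of_nonneg ht'.le hane)
    (ENNReal.rpow_ne_top_of_nonneg ht.1.le hbne)
  have hc0 : c ≠ 0 := by
    refine mul_ne_zero ?_ ?_
    · simp [ENNReal.rpow_eq_zero_iff, hf1, hane]
    · simp [ENNReal.rpow_eq_zero_iff, hg1, hbne]
  have hmul : ∀ u v : ℝ≥0∞, (a⁻¹ * u) ^ (1 - t) * (b⁻¹ * v) ^ t = c * (u ^ (1 - t) * v ^ t) := by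
    intro u v
    rw [ENNReal.mul_rpow_of_nonneg _ _ ht'.le, ENNReal.mul_rpow_of_nonneg _ _ ht.1.le, hc]
    ring
  have := prekopaLeindler_real_of_iSup_eq_one ht (hf.const_mul a⁻¹) (hg.const_mul b⁻¹)
    (hh.const_mul c) (by rw [← ENNReal.mul_iSup, ← ha, ENNReal.inv_mul_cancel ha0 hf1])
    (by rw [← ENNReal.mul_iSup, ← hb, ENNReal.inv_mul_cancel hb0 hg1])
    (fun x y => by rw [hmul]; gcongr; exact H x y)
  rw [lintegral_const_mul' _ _ hane, lintegral_const_mul' _ _ hbne, lintegral_const_mul' _ _ hcne,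
    hmul] at this
  exact (ENNReal.mul_le_mul_iff_right hc0 hcne).1 this

/-- The Prékopa–Leindler inequality on the line. -/
theorem prekopaLeindler_real : PrekopaLeindler ℝ := by
  intro t ht f g h hf hg hh H
  have ht' : 0 < 1 - t := by linarith [ht.2]
  have htrunc : ∀ {u : ℝ → ℝ≥0∞}, Measurable u →
      Tendsto (fun k : ℕ => ∫⁻ x, min (u x) k) atTop (𝓝 (∫⁻ x, u x)) := by
    intro u hu
    refine lintegral_tendsto_of_tendsto_of_monotone
      (fun k => (hu.min measurable_const).aemeasurable)
      (Eventually.of_forall fun x i j hij => min_le_min_left _ (by exact_mod_cast hij))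
      (Eventually.of_forall fun x => ?_)
    have := (tendsto_const_nhds (x := u x)).min ENNReal.tendsto_nat_nhds_top
    simpa using this
  have hstep : ∀ k : ℕ, (∫⁻ x, min (f x) k) ^ (1 - t) * (∫⁻ x, min (g x) k) ^ t ≤ ∫⁻ x, h x := by
    intro k
    refine prekopaLeindler_real_of_iSup_ne_top ht (hf.min measurable_const)
      (hg.min measurable_const) hh ?_ ?_ fun x y => le_trans ?_ (H x y)
    · exact ((iSup_le fun x => min_le_right _ _).trans_lt (ENNReal.natCast_lt_top k)).ne
    · exact ((iSup_le fun x => min_le_right _ _).trans_lt (ENNReal.natCast_lt_top k)).ne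
    · exact mul_le_mul' (ENNReal.rpow_le_rpow (min_le_left _ _) ht'.le)
        (ENNReal.rpow_le_rpow (min_le_left _ _) ht.1.le)
  have hmono : ∀ {u : ℝ → ℝ≥0∞}, Measurable u → (∫⁻ x, u x) = ⨆ k : ℕ, ∫⁻ x, min (u x) k :=
    fun hu => tendsto_nhds_unique (htrunc hu) (tendsto_atTop_iSup fun i j hij =>
      lintegral_mono fun x => min_le_min_left _ (by exact_mod_cast hij))
  have hpow : ∀ {u : ℕ → ℝ≥0∞} {p : ℝ}, 0 < p → (⨆ k, u k) ^ p = ⨆ k, u k ^ p :=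
    fun hp => (ENNReal.orderIsoRpow _ hp).map_iSup _
  rw [hmono hf, hmono hg, hpow ht', hpow ht.1]
  simp only [ENNReal.iSup_mul, ENNReal.mul_iSup]
  -- The two truncation levels vary independently; both are dominated by their maximum.
  refine iSup_le fun i => iSup_le fun j => (mul_le_mul' ?_ ?_).trans (hstep (max i j))
  · refine ENNReal.rpow_le_rpow (lintegral_mono fun x => min_le_min_left _ ?_) ht'.le
    exact_mod_cast le_max_right i j
  · refine ENNReal.rpow_le_rpow (lintegral_mono fun x => min_le_min_left _ ?_) ht.1.le
    exact_mod_cast le_max_left i j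

/-- The Prékopa–Leindler inequality on `ℝᵐ`. -/
theorem prekopaLeindler_pi (m : ℕ) : PrekopaLeindler (Fin m → ℝ) := by
  induction m with
  | zero =>
    intro t ht f g h _ _ _ H
    have hint : ∀ u : (Fin 0 → ℝ) → ℝ≥0∞, ∫⁻ x, u x = u 0 := fun u => by
      rw [lintegral_unique, volume_pi, Measure.pi_univ, Finset.univ_eq_empty, Finset.prod_empty,
        mul_one]
      exact congrArg u (Subsingleton.elim _ _)
    simpa [hint] using H 0 0
  | succ m ih =>
    refine (prekopaLeindler_real.prod ih).of_linearEquiv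
      (Fin.consLinearEquiv ℝ (fun _ => ℝ)) ?_
    have h : ⇑(Fin.consLinearEquiv ℝ (fun _ : Fin (m + 1) => ℝ)) =
        (MeasurableEquiv.piFinSuccAbove (fun _ : Fin (m + 1) => ℝ) 0).symm := by
      ext p
      simp [MeasurableEquiv.piFinSuccAbove, Fin.insertNthEquiv]
    rw [h]
    exact (volume_preserving_piFinSuccAbove (fun _ : Fin (m + 1) => ℝ) 0).symm

/-! ### Extremality of the Laplace density -/

lemma lintegral_abs_pow_mul_exp {c : ℝ} (hc : 0 < c) (k : ℕ) :
    ∫⁻ t : ℝ, ENNReal.ofReal (|t| ^ k * (c * Real.exp (-(2 * c * |t|)))) =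
      ENNReal.ofReal (2 * c * ((1 / (2 * c)) ^ (k + 1) * k.factorial)) := by
  have hint : ∫ t : ℝ, |t| ^ k * (c * Real.exp (-(2 * c * |t|))) =
      2 * c * ((1 / (2 * c)) ^ (k + 1) * k.factorial) := by
    rw [integral_comp_abs (f := fun s => s ^ k * (c * Real.exp (-(2 * c * s))))]
    have h := Real.integral_rpow_mul_exp_neg_mul_Ioi (a := k + 1) (r := 2 * c) (by positivity)
      (by positivity)
    simp only [add_sub_cancel_right, Real.rpow_natCast, Real.Gamma_nat_eq_factorial] at h
    norm_cast at h
    rw [mul_assoc 2 c, ← h, ← integral_const_mul c]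
    congr 2
    ext s
    ring
  rw [← hint, ofReal_integral_eq_lintegral_ofReal]
  · refine Integrable.of_integral_ne_zero ?_
    rw [hint]
    positivity
  · exact Eventually.of_forall fun t => by positivity

/-- Among even functions `G` with integral one and log-concave along rays from the origin, the
Laplace density has the largest value at the origin for a given second moment. -/
theorem two_mul_sq_le_one_of_even {G : ℝ → ℝ≥0∞} (hG : Measurable G) (heven : ∀ t, G (-t) = G t)
    {c : ℝ} (hc : 0 < c) (h0 : ENNReal.ofReal c ≤ G 0)
    (hlc : ∀ t, ∀ l ∈ Set.Ioo (0 : ℝ) 1, ENNReal.ofReal c ^ (1 - l) * G t ^ l ≤ G (l * t))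
    (h1 : ∫⁻ t, G t = 1) (h2 : 1 ≤ ∫⁻ t, ENNReal.ofReal (t ^ 2) * G t) : 2 * c ^ 2 ≤ 1 := by
  -- The exponent `2 * c` is chosen so that `E` has mass one with `E 0 = c`.
  set E : ℝ → ℝ≥0∞ := fun t => ENNReal.ofReal (c * Real.exp (-(2 * c * |t|))) with hE
  have hEm : Measurable E := by fun_prop
  have hE1 : ∫⁻ t, E t = 1 := by
    have h := lintegral_abs_pow_mul_exp hc 0
    simp only [pow_zero, one_mul] at h
    rw [hE, h, zero_add, pow_one, Nat.factorial_zero, Nat.cast_one, mul_one,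
      mul_one_div_cancel (by positivity), ENNReal.ofReal_one]
  have hE2 : ∫⁻ t, ENNReal.ofReal (t ^ 2) * E t = ENNReal.ofReal (1 / (2 * c ^ 2)) := by
    have h := lintegral_abs_pow_mul_exp hc 2
    simp only [sq_abs] at h
    simp only [hE, ← ENNReal.ofReal_mul (sq_nonneg _)]
    rw [h]
    congr 1
    rw [div_pow, Nat.factorial_two]
    push_cast
    field_simp
  suffices h : (1 : ℝ≥0∞) ≤ ENNReal.ofReal (1 / (2 * c ^ 2)) by
    rw [ENNReal.one_le_ofReal, le_div_iff₀ (by positivity)] at h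
    linarith
  have hGabs : ∀ t, G |t| = G t := fun t => by
    rcases abs_choice t with h | h <;> rw [h]
    exact heven t
  have hEabs : ∀ t, E |t| = E t := fun t => by simp [hE]
  -- On the positive half-line `log E` is affine and starts at `log c`, while `G` satisfies the
  -- concavity inequality from height `c`. So `G ≥ E` at `u` propagates down to every `s < u`, and
  -- `G` crosses `E` at most once.
  have hdown : ∀ s u : ℝ, 0 < s → s < u → E u ≤ G u → E s ≤ G s := by
    intro s u hs hsu hu
    have hu0 : 0 < u := hs.trans hsu
    have hl : s / u ∈ Set.Ioo (0 : ℝ) 1 := ⟨by positivity, (div_lt_one hu0).2 hsu⟩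
    have hl' : 0 < 1 - s / u := by linarith [hl.2]
    have := hlc u (s / u) hl
    rw [div_mul_cancel₀ _ hu0.ne'] at this
    refine le_trans ?_ ((mul_le_mul_right (ENNReal.rpow_le_rpow hu hl.1.le) _).trans this)
    simp only [hE, abs_of_pos hs, abs_of_pos hu0]
    rw [ENNReal.ofReal_rpow_of_pos hc, ENNReal.ofReal_rpow_of_pos (by positivity),
      ← ENNReal.ofReal_mul (by positivity)]
    refine ENNReal.ofReal_le_ofReal (le_of_eq ?_)
    rw [Real.mul_rpow hc.le (Real.exp_pos _).le, ← mul_assoc, ← Real.rpow_add hc, ← Real.exp_mul]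
    simp only [sub_add_cancel, Real.rpow_one]
    congr 2
    field_simp
  set T : Set ℝ := {t | 0 < t ∧ E t ≤ G t} with hT
  by_cases hbdd : BddAbove T
  · set t₀ := sSup T with ht₀
    have hlow : ∀ t, |t| < t₀ → E t ≤ G t := by
      intro t ht
      rcases eq_or_ne t 0 with rfl | hne
      · simpa [hE] using h0
      have hTne : T.Nonempty := by
        by_contra hemp
        rw [Set.not_nonempty_iff_eq_empty] at hemp
        -- For empty `T` the default `sSup ∅ = 0` gives `t₀ = 0`, contradicting `|t| < t₀`.
        rw [ht₀, hemp, Real.sSup_empty] at ht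
        exact absurd ht (abs_nonneg t).not_gt
      obtain ⟨u, hu, htu⟩ := exists_lt_of_lt_csSup hTne ht
      have := hdown |t| u (abs_pos.2 hne) htu hu.2
      rwa [hEabs, hGabs] at this
    have ht₀nn : 0 ≤ t₀ := Real.sSup_nonneg fun t ht => ht.1.le
    have hhigh : ∀ t, t₀ < |t| → G t ≤ E t := by
      intro t ht
      by_contra hlt
      have : |t| ∈ T := ⟨ht₀nn.trans_lt ht, by rw [hEabs, hGabs]; exact (not_le.1 hlt).le⟩
      exact absurd (le_csSup hbdd this) (not_le.2 ht)
    have hswap : ∀ {a b x y : ℝ≥0∞}, a ≤ b → x ≤ y → a * y + b * x ≤ a * x + b * y := by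
      intro a b x y hab hxy
      obtain ⟨d, rfl⟩ := exists_add_of_le hab
      rw [add_mul, add_mul]
      calc a * y + (a * x + d * x) = a * x + (a * y + d * x) := by ring
        _ ≤ a * x + (a * y + d * y) := by gcongr
    -- This is `(t² - t₀²)(G t - E t) ≤ 0` without subtraction. After integration the `t₀²` terms
    -- cancel because both masses are one.
    have hpt : ∀ t, ENNReal.ofReal (t ^ 2) * G t + ENNReal.ofReal (t₀ ^ 2) * E t ≤
        ENNReal.ofReal (t ^ 2) * E t + ENNReal.ofReal (t₀ ^ 2) * G t := by
      intro t
      rcases lt_trichotomy |t| t₀ with h | h | h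
      · exact hswap (ENNReal.ofReal_le_ofReal (sq_le_sq' (by linarith [neg_abs_le t])
          ((le_abs_self t).trans h.le))) (hlow t h)
      · rw [← h, sq_abs, add_comm]
      · have := hswap (ENNReal.ofReal_le_ofReal
          (show t₀ ^ 2 ≤ t ^ 2 from sq_le_sq.2 (by rw [abs_of_nonneg ht₀nn]; exact h.le)))
          (hhigh t h)
        rw [add_comm, add_comm (ENNReal.ofReal (t ^ 2) * E t)]
        exact this
    have hI := lintegral_mono (μ := volume) hpt
    rw [lintegral_add_left (by fun_prop), lintegral_add_left (by fun_prop),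
      lintegral_const_mul _ hEm, lintegral_const_mul _ hG, hE1, h1, hE2, mul_one,
      ENNReal.add_le_add_iff_right ENNReal.ofReal_ne_top] at hI
    exact h2.trans hI
  -- With no crossing, `E ≤ G` everywhere, and equal masses force equality almost everywhere.
  · have hle : ∀ t, E t ≤ G t := by
      intro t
      rcases eq_or_ne t 0 with rfl | hne
      · simpa [hE] using h0
      obtain ⟨u, hu, htu⟩ := not_bddAbove_iff.1 hbdd |t|
      have := hdown |t| u (abs_pos.2 hne) htu hu.2
      rwa [hEabs, hGabs] at this
    have hae : E =ᵐ[volume] G := ae_eq_of_ae_le_of_lintegral_le (Eventually.of_forall hle)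
      (by rw [hE1]; exact ENNReal.one_ne_top) hG.aemeasurable (by rw [hE1, h1])
    rw [← hE2]
    refine h2.trans (le_of_eq (lintegral_congr_ae ?_))
    filter_upwards [hae] with t ht
    rw [ht]

/-! ### Layers on a line and slicing along one coordinate -/

lemma volume_le_of_forall_sub_le {ε : ℝ} {U : Set ℝ} (hU : ∀ u ∈ U, ∀ v ∈ U, u - v ≤ ε) :
    volume U ≤ ENNReal.ofReal ε := by
  refine (Real.volume_le_diam U).trans (Metric.ediam_le fun u hu v hv => ?_)
  rw [edist_dist, Real.dist_eq]
  exact ENNReal.ofReal_le_ofReal (abs_sub_le_iff.2 ⟨hU u hu v hv, hU v hv u hu⟩)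

/-- The layer of width `ε` around a convex subset of the line has length at most `2 * ε`. -/
lemma volume_layer_le {J : Set ℝ} (hJ : J.OrdConnected) {ε : ℝ} (hε : 0 ≤ ε) :
    volume {t | t ∉ J ∧ ∃ s ∈ J, |t - s| ≤ ε} ≤ ENNReal.ofReal (2 * ε) := by
  -- The parts to the right and to the left of `J` each have diameter at most `ε`: a larger gap
  -- would place a point of the layer between two points of `J`.
  have hsub : {t | t ∉ J ∧ ∃ s ∈ J, |t - s| ≤ ε} ⊆
      {t | t ∉ J ∧ ∃ s ∈ J, s ≤ t ∧ t ≤ s + ε} ∪ {t | t ∉ J ∧ ∃ s ∈ J, t ≤ s ∧ s ≤ t + ε} := by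
    rintro t ⟨ht, s, hs, hts⟩
    rw [abs_le] at hts
    rcases le_total s t with h | h
    · exact Or.inl ⟨ht, s, hs, h, by linarith⟩
    · exact Or.inr ⟨ht, s, hs, h, by linarith⟩
  refine (measure_mono hsub).trans ((measure_union_le _ _).trans ?_)
  rw [two_mul, ENNReal.ofReal_add hε hε]
  refine add_le_add (volume_le_of_forall_sub_le ?_) (volume_le_of_forall_sub_le ?_)
  · rintro u ⟨hu, s, hs, hsu, hus⟩ v ⟨hv, r, hr, hrv, -⟩
    by_contra hlt
    exact hv (hJ.out hr hs ⟨hrv, by linarith⟩)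
  · rintro u ⟨hu, s, hs, hus, -⟩ v ⟨hv, r, hr, -, hrv⟩
    by_contra hlt
    exact hu (hJ.out hr hs ⟨by linarith, hus⟩)

lemma insertNth_convexCombination {m : ℕ} (i : Fin (m + 1)) (a b s t : ℝ) (x y : Fin m → ℝ) :
    a • (i.insertNth s x : Fin (m + 1) → ℝ) + b • (i.insertNth t y : Fin (m + 1) → ℝ) =
      i.insertNth (a * s + b * t) (a • x + b • y) := by
  ext j
  refine Fin.succAboveCases i ?_ (fun k => ?_) j <;> simp

/-- The segment `[-ε, ε]` on the `i`-th coordinate axis. -/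
def axisSegment {n : ℕ} (i : Fin n) (ε : ℝ) : Set (Fin n → ℝ) :=
  Pi.single i '' Set.Icc (-ε) ε

lemma convex_axisSegment {n : ℕ} (i : Fin n) (ε : ℝ) : Convex ℝ (axisSegment i ε) :=
  (convex_Icc (-ε) ε).linear_image (LinearMap.single ℝ (fun _ => ℝ) i)

/-- Log-concavity of a function on a real vector space, at interior weights. -/
def IsLogConcaveMap {E : Type*} [AddCommGroup E] [Module ℝ E] (F : E → ℝ) : Prop :=
  ∀ x y : E, ∀ t ∈ Set.Ioo (0 : ℝ) 1, F x ^ (1 - t) * F y ^ t ≤ F ((1 - t) • x + t • y)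

section Coordinate

variable {m : ℕ} {i : Fin (m + 1)} {F : (Fin (m + 1) → ℝ) → ℝ}

lemma lintegral_insertNth (i : Fin (m + 1)) {u : (Fin (m + 1) → ℝ) → ℝ≥0∞}
    (hu : AEMeasurable u) :
    ∫⁻ x, u x = ∫⁻ y : Fin m → ℝ, ∫⁻ t : ℝ, u (i.insertNth t y) := by
  have he := (volume_preserving_piFinSuccAbove (fun _ : Fin (m + 1) => ℝ) i).symm
  rw [← he.lintegral_comp_emb (MeasurableEquiv.measurableEmbedding _), Measure.volume_eq_prod,
    lintegral_prod_symm]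
  · rfl
  · exact hu.comp_quasiMeasurePreserving he.quasiMeasurePreserving

lemma lintegral_insertNth' (i : Fin (m + 1)) {u : (Fin (m + 1) → ℝ) → ℝ≥0∞}
    (hu : AEMeasurable u) :
    ∫⁻ x, u x = ∫⁻ t : ℝ, ∫⁻ y : Fin m → ℝ, u (i.insertNth t y) := by
  have he := (volume_preserving_piFinSuccAbove (fun _ : Fin (m + 1) => ℝ) i).symm
  rw [← he.lintegral_comp_emb (MeasurableEquiv.measurableEmbedding _), Measure.volume_eq_prod,
    lintegral_prod]
  · rfl
  · exact hu.comp_quasiMeasurePreserving he.quasiMeasurePreserving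

lemma measurable_insertNth (i : Fin (m + 1)) :
    Measurable fun p : ℝ × (Fin m → ℝ) => (i.insertNth p.1 p.2 : Fin (m + 1) → ℝ) :=
  (MeasurableEquiv.piFinSuccAbove (fun _ : Fin (m + 1) => ℝ) i).symm.measurable

/-- The point on the hyperplane is the midpoint of the given point and its reflection, where `F`
takes equal values. -/
lemma insertNth_le_insertNth_zero (hF0 : ∀ x, 0 ≤ F x) (hlc : IsLogConcaveMap F)
    (heven : ∀ t y, F (i.insertNth (-t) y) = F (i.insertNth t y)) (t : ℝ) (y : Fin m → ℝ) :
    F (i.insertNth t y) ≤ F (i.insertNth 0 y) := by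
  have h := hlc (i.insertNth (-t) y) (i.insertNth t y) (1 / 2) (by norm_num)
  rw [insertNth_convexCombination, heven, ← Real.rpow_add_of_nonneg (hF0 _) (by norm_num)
    (by norm_num), ← add_smul] at h
  convert h using 3 <;> norm_num

/-- A convex set enlarged along the `i`-th axis gains at most `2 * ε` times the mass of the
hyperplane section through the origin. -/
lemma withDensity_add_axisSegment_sdiff_le (hFc : Continuous F) (hF0 : ∀ x, 0 ≤ F x)
    (hlc : IsLogConcaveMap F)
    (heven : ∀ t y, F (i.insertNth (-t) y) = F (i.insertNth t y))
    {B : Set (Fin (m + 1) → ℝ)} (hB : Convex ℝ B) {ε : ℝ} (hε : 0 ≤ ε) :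
    volume.withDensity (fun x => ENNReal.ofReal (F x)) ((B + axisSegment i ε) \ B) ≤
      ENNReal.ofReal (2 * ε) * ∫⁻ y : Fin m → ℝ, ENNReal.ofReal (F (i.insertNth 0 y)) := by
  set D := (B + axisSegment i ε) \ B with hD
  -- Convex sets are null-measurable, so `B` need not be measurable.
  have hDm : NullMeasurableSet D := ((hB.add (convex_axisSegment i ε)).nullMeasurableSet _).diff
    (hB.nullMeasurableSet _)
  have hFm : Measurable fun x => ENNReal.ofReal (F x) := hFc.measurable.ennreal_ofReal
  rw [withDensity_apply' _ D, ← lintegral_indicator₀ hDm, lintegral_insertNth i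
    ((aemeasurable_indicator_iff₀ hDm).2 hFm.aemeasurable),
    ← lintegral_const_mul' _ _ ENNReal.ofReal_ne_top]
  refine lintegral_mono fun y => ?_
  set J : Set ℝ := {t | i.insertNth t y ∈ B} with hJ
  have hJc : J.OrdConnected := by
    refine Convex.ordConnected fun s hs t ht a b ha hb hab => ?_
    have h := hB hs ht ha hb hab
    rw [insertNth_convexCombination, ← add_smul, hab, one_smul] at h
    exact h
  calc ∫⁻ t : ℝ, D.indicator (fun x => ENNReal.ofReal (F x)) (i.insertNth t y)
      ≤ ∫⁻ t : ℝ, {t | t ∉ J ∧ ∃ s ∈ J, |t - s| ≤ ε}.indicator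
          (fun _ => ENNReal.ofReal (F (i.insertNth 0 y))) t := by
        refine lintegral_mono fun t => ?_
        by_cases ht : i.insertNth t y ∈ D
        · rw [Set.indicator_of_mem ht, Set.indicator_of_mem]
          · exact ENNReal.ofReal_le_ofReal (insertNth_le_insertNth_zero hF0 hlc heven t y)
          · refine ⟨ht.2, ?_⟩
            obtain ⟨b, hb, _, ⟨s, hs, rfl⟩, hbs⟩ := ht.1
            have : b = i.insertNth (t - s) y := by
              rw [eq_sub_of_add_eq hbs]
              ext j
              refine Fin.succAboveCases i ?_ (fun k => ?_) j <;> simp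
            refine ⟨t - s, show i.insertNth (t - s) y ∈ B from this ▸ hb, ?_⟩
            rw [sub_sub_cancel]
            exact abs_le.2 hs
        · rw [Set.indicator_of_notMem ht]
          exact zero_le
    _ ≤ ENNReal.ofReal (F (i.insertNth 0 y)) * volume {t | t ∉ J ∧ ∃ s ∈ J, |t - s| ≤ ε} :=
        lintegral_indicator_const_le _ _
    _ ≤ ENNReal.ofReal (2 * ε) * ENNReal.ofReal (F (i.insertNth 0 y)) := by
        rw [mul_comm]
        gcongr
        exact volume_layer_le hJc hε

/-- The central section orthogonal to the `i`-th axis of a log-concave probability density, even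
in the `i`-th coordinate and with second moment at least one there, has mass at most `1 / √2`. -/
lemma lintegral_section_le (hFc : Continuous F) (hF0 : ∀ x, 0 ≤ F x)
    (hlc : IsLogConcaveMap F)
    (heven : ∀ t y, F (i.insertNth (-t) y) = F (i.insertNth t y))
    (h1 : ∫⁻ x, ENNReal.ofReal (F x) = 1)
    (h2 : 1 ≤ ∫⁻ x, ENNReal.ofReal (x i ^ 2) * ENNReal.ofReal (F x)) :
    ∫⁻ y : Fin m → ℝ, ENNReal.ofReal (F (i.insertNth 0 y)) ≤ ENNReal.ofReal (1 / √2) := by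
  have hFm : Measurable fun x => ENNReal.ofReal (F x) := hFc.measurable.ennreal_ofReal
  have hFm' : Measurable fun p : ℝ × (Fin m → ℝ) =>
      ENNReal.ofReal (F (i.insertNth p.1 p.2)) := hFm.comp (measurable_insertNth i)
  set G : ℝ → ℝ≥0∞ := fun t => ∫⁻ y : Fin m → ℝ, ENNReal.ofReal (F (i.insertNth t y)) with hG
  have hGm : Measurable G := hFm'.lintegral_prod_right'
  have hslice : ∀ t, Measurable fun y : Fin m → ℝ => ENNReal.ofReal (F (i.insertNth t y)) :=
    fun t => hFm'.comp measurable_prodMk_left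
  rw [lintegral_insertNth' i hFm.aemeasurable] at h1
  rw [lintegral_insertNth' i (by fun_prop)] at h2
  simp only [Fin.insertNth_apply_same] at h2
  simp only [lintegral_const_mul' _ _ ENNReal.ofReal_ne_top] at h2
  change ∫⁻ t, G t = 1 at h1
  change 1 ≤ ∫⁻ t, ENNReal.ofReal (t ^ 2) * G t at h2
  change G 0 ≤ _
  by_contra hlt
  -- `G 0` is not known to be finite, so the comparison uses a real `c` strictly between `1 / √2`
  -- and `G 0`.
  obtain ⟨c, hc1, hc2⟩ := ENNReal.lt_iff_exists_nnreal_btwn.1 (not_le.1 hlt)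
  have hc : 1 / √2 < (c : ℝ) := by
    rwa [← ENNReal.ofReal_coe_nnreal, ENNReal.ofReal_lt_ofReal_iff_of_nonneg (by positivity)]
      at hc1
  have hc0 : (0 : ℝ) < c := lt_trans (by positivity) hc
  have := two_mul_sq_le_one_of_even hGm (fun t => by simp only [hG, heven]) hc0
    (by rw [ENNReal.ofReal_coe_nnreal]; exact hc2.le) (fun t l hl => ?_) h1 h2
  · rw [div_lt_iff₀ (by positivity)] at hc
    have h3 : 1 < (c * √2 : ℝ) ^ 2 := one_lt_pow₀ hc two_ne_zero
    rw [mul_pow, Real.sq_sqrt zero_le_two] at h3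
    linarith
  · have hl' : 0 < 1 - l := by linarith [hl.2]
    -- Prékopa–Leindler on the slices at heights `0`, `t` and `l * t` gives log-concavity of `G`
    -- along rays from `0`.
    refine le_trans (mul_le_mul_left (ENNReal.rpow_le_rpow ?_ hl'.le) _)
      (prekopaLeindler_pi m l hl _ _ _ (hslice 0) (hslice t) (hslice (l * t)) fun x y => ?_)
    · rw [ENNReal.ofReal_coe_nnreal]; exact hc2.le
    · rw [ENNReal.ofReal_rpow_of_nonneg (hF0 _) hl'.le,
        ENNReal.ofReal_rpow_of_nonneg (hF0 _) hl.1.le,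
        ← ENNReal.ofReal_mul (Real.rpow_nonneg (hF0 _) _)]
      refine ENNReal.ofReal_le_ofReal ?_
      have := hlc (i.insertNth 0 x) (i.insertNth t y) l hl
      rwa [insertNth_convexCombination, mul_zero, zero_add] at this

end Coordinate

/-! ### From the measure on Euclidean space to coordinates, and assembly -/

section

variable {n : ℕ} {μ : Measure (EuclideanSpace ℝ (Fin n))} {f : EuclideanSpace ℝ (Fin n) → ℝ}

lemma IsDensity.lintegral_eq_one [IsProbabilityMeasure μ] (hf : IsDensity μ f) :
    ∫⁻ x, ENNReal.ofReal (f x) = 1 := by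
  have h : μ Set.univ = 1 := measure_univ
  rwa [hf.eq_withDensity, withDensity_apply _ MeasurableSet.univ, Measure.restrict_univ] at h

lemma IsDensity.ae_eq [IsProbabilityMeasure μ] {g : EuclideanSpace ℝ (Fin n) → ℝ}
    (hf : IsDensity μ f) (hg : IsDensity μ g) : f =ᵐ[volume] g := by
  have h := (withDensity_eq_iff hf.aemeasurable.ennreal_ofReal hg.aemeasurable.ennreal_ofReal
    (by rw [hf.lintegral_eq_one]; exact ENNReal.one_ne_top)).1
    (hf.eq_withDensity.symm.trans hg.eq_withDensity)
  filter_upwards [h] with x hx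
  exact (ENNReal.ofReal_eq_ofReal_iff (hf.nonneg x) (hg.nonneg x)).1 hx

/-- A continuous function which agrees almost everywhere with a log-concave one is log-concave. -/
lemma isLogConcaveMap_of_ae_eq {g : EuclideanSpace ℝ (Fin n) → ℝ} (hfc : Continuous f)
    (hg : LogConcaveFun g) (hfg : f =ᵐ[volume] g) : IsLogConcaveMap f := by
  intro x y t ht
  have ht' : 0 < 1 - t := by linarith [ht.2]
  have htrans : ∀ z, ∀ᵐ u, f (u + z) = g (u + z) := fun z =>
    (measurePreserving_add_right volume z).quasiMeasurePreserving.ae hfg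
  -- The three points are translated by a common `u`. The inequality for `f` holds for almost every
  -- `u`, hence on a dense set; as `C` is closed, it contains `u = 0`.
  set C := {u | f (u + x) ^ (1 - t) * f (u + y) ^ t ≤ f (u + ((1 - t) • x + t • y))} with hC
  have hclosed : IsClosed C := by
    refine isClosed_le (Continuous.mul ?_ ?_) (by fun_prop)
    · exact (hfc.comp (by fun_prop)).rpow_const fun _ => Or.inr ht'.le
    · exact (hfc.comp (by fun_prop)).rpow_const fun _ => Or.inr ht.1.le
  have hae : ∀ᵐ u, u ∈ C := by
    filter_upwards [htrans x, htrans y, htrans ((1 - t) • x + t • y)] with u hx hy hz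
    have h := hg (u + x) (u + y) (1 - t) ⟨ht'.le, by linarith [ht.1]⟩
    rw [sub_sub_cancel] at h
    simp only [hC, Set.mem_ofPred_eq]
    rw [hx, hy, hz]
    convert h using 2
    module
  have h0 : (0 : EuclideanSpace ℝ (Fin n)) ∈ C := by
    rw [← hclosed.closure_eq]
    exact Measure.dense_of_ae hae 0
  simpa [hC] using h0

lemma IsDensity.apply_eq (hf : IsDensity μ f) (S : Set (EuclideanSpace ℝ (Fin n))) :
    μ S = volume.withDensity (fun x : Fin n → ℝ => ENNReal.ofReal (f (WithLp.toLp 2 x)))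
      (WithLp.toLp 2 ⁻¹' S) := by
  rw [hf.eq_withDensity, withDensity_apply', withDensity_apply',
    ← (PiLp.volume_preserving_toLp (Fin n)).setLIntegral_comp_preimage_emb
      (MeasurableEquiv.toLp 2 (Fin n → ℝ)).measurableEmbedding]

lemma IsIsotropic.one_le_lintegral [IsProbabilityMeasure μ] (hiso : IsIsotropic μ)
    (hf : IsDensity μ f) (i : Fin n) :
    1 ≤ ∫⁻ x : Fin n → ℝ,
      ENNReal.ofReal (x i ^ 2) * ENNReal.ofReal (f (WithLp.toLp 2 x)) := by
  have hm : Measurable fun x : EuclideanSpace ℝ (Fin n) => x i := by fun_prop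
  have hcov := congrFun (congrFun hiso.covariance_eq_one i) i
  rw [Matrix.of_apply, Matrix.one_apply_eq, covariance_self hm.aemeasurable] at hcov
  have hle : 1 ≤ ∫ x, x i ^ 2 ∂μ :=
    hcov.symm.le.trans (variance_le_expectation_sq hm.aestronglyMeasurable)
  -- The integral is at least one, hence not the default value `0`.
  have hint : Integrable (fun x : EuclideanSpace ℝ (Fin n) => x i ^ 2) μ :=
    Integrable.of_integral_ne_zero (by linarith)
  calc (1 : ℝ≥0∞) ≤ ENNReal.ofReal (∫ x, x i ^ 2 ∂μ) := ENNReal.one_le_ofReal.2 hle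
    _ = ∫⁻ x, ENNReal.ofReal (x i ^ 2) ∂μ :=
        ofReal_integral_eq_lintegral_ofReal hint (Eventually.of_forall fun x => sq_nonneg _)
    _ = ∫⁻ x, ENNReal.ofReal (x i ^ 2) * ENNReal.ofReal (f x) := by
        rw [hf.eq_withDensity, lintegral_withDensity_eq_lintegral_mul₀
          hf.aemeasurable.ennreal_ofReal (by fun_prop)]
        simp only [Pi.mul_apply, mul_comm]
    _ = _ := ((PiLp.volume_preserving_toLp (Fin n)).lintegral_comp_emb
        (MeasurableEquiv.toLp 2 (Fin n → ℝ)).measurableEmbedding _).symm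

lemma IsUnconditional.insertNth_neg {m : ℕ} {f : EuclideanSpace ℝ (Fin (m + 1)) → ℝ}
    (hunc : IsUnconditional f) (i : Fin (m + 1)) (t : ℝ) (y : Fin m → ℝ) :
    f (WithLp.toLp 2 (i.insertNth (-t) y)) = f (WithLp.toLp 2 (i.insertNth t y)) := by
  rw [← hunc (i.insertNth (-1) fun _ => 1) (fun j => by
    refine Fin.succAboveCases i ?_ (fun k => ?_) j <;> simp) (WithLp.toLp 2 (i.insertNth t y))]
  congr 2
  ext j
  refine Fin.succAboveCases i ?_ (fun k => ?_) j <;> simp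

lemma measure_add_axisSegment_sdiff_le (hfc : Continuous f) (hf0 : ∀ x, 0 ≤ f x)
    (hlc : IsLogConcaveMap f) (hunc : IsUnconditional f)
    (h1 : ∫⁻ x : Fin n → ℝ, ENNReal.ofReal (f (WithLp.toLp 2 x)) = 1) (i : Fin n)
    (h2 : 1 ≤ ∫⁻ x : Fin n → ℝ, ENNReal.ofReal (x i ^ 2) * ENNReal.ofReal (f (WithLp.toLp 2 x)))
    {B : Set (Fin n → ℝ)} (hB : Convex ℝ B) {ε : ℝ} (hε : 0 ≤ ε) :
    volume.withDensity (fun x : Fin n → ℝ => ENNReal.ofReal (f (WithLp.toLp 2 x)))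
      ((B + axisSegment i ε) \ B) ≤ ENNReal.ofReal (√2 * ε) := by
  obtain ⟨m, rfl⟩ : ∃ m, n = m + 1 := ⟨n - 1, by have := i.2; omega⟩
  have hFc : Continuous fun x : Fin (m + 1) → ℝ => f (WithLp.toLp 2 x) :=
    hfc.comp (PiLp.continuous_toLp 2 _)
  have hFlc : IsLogConcaveMap fun x : Fin (m + 1) → ℝ => f (WithLp.toLp 2 x) := fun x y t ht =>
    hlc (WithLp.toLp 2 x) (WithLp.toLp 2 y) t ht
  refine (withDensity_add_axisSegment_sdiff_le hFc (fun x => hf0 _) hFlc (hunc.insertNth_neg i)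
    hB hε).trans ?_
  refine (mul_le_mul_right (lintegral_section_le hFc (fun x => hf0 _) hFlc (hunc.insertNth_neg i)
    h1 h2) _).trans ?_
  rw [← ENNReal.ofReal_mul (by positivity)]
  refine ENNReal.ofReal_le_ofReal (le_of_eq ?_)
  field_simp
  rw [Real.sq_sqrt zero_le_two, mul_comm]

/-- Each new layer is charged to the convex set already built, so the per-summand bound applies at
every stage and the costs add up. -/
lemma measure_add_sum_sdiff_le {ι E : Type*} [AddCommGroup E] [Module ℝ E] [MeasurableSpace E]
    {ν : Measure E} {S : ι → Set E} (hS : ∀ i, Convex ℝ (S i)) {K : ℝ≥0∞}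
    (h : ∀ i, ∀ B : Set E, Convex ℝ B → ν ((B + S i) \ B) ≤ K) (s : Finset ι) {A : Set E}
    (hA : Convex ℝ A) : ν ((A + ∑ i ∈ s, S i) \ A) ≤ s.card * K := by
  classical
  induction s using Finset.induction_on with
  | empty => simp
  | insert i s hi ih =>
    set B := A + ∑ j ∈ s, S j with hB
    have hBc : Convex ℝ B := hA.add (convex_sum _ fun j _ => hS j)
    have hsub : (A + ∑ j ∈ insert i s, S j) \ A ⊆ ((B + S i) \ B) ∪ (B \ A) := by
      rw [Finset.sum_insert hi, add_comm (S i), ← add_assoc, ← hB]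
      intro x hx
      by_cases hxB : x ∈ B
      · exact Or.inr ⟨hxB, hx.2⟩
      · exact Or.inl ⟨hx.1, hxB⟩
    calc ν ((A + ∑ j ∈ insert i s, S j) \ A) ≤ ν ((B + S i) \ B) + ν (B \ A) :=
          (measure_mono hsub).trans (measure_union_le _ _)
      _ ≤ K + s.card * K := add_le_add (h i B hBc) ih
      _ = (insert i s).card * K := by
          rw [Finset.card_insert_of_notMem hi]
          push_cast
          ring

lemma preimage_outerLayer_subset (A : Set (EuclideanSpace ℝ (Fin n))) {ε : ℝ} (hε : 0 ≤ ε) :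
    WithLp.toLp 2 ⁻¹' outerLayer A ε ⊆
      (WithLp.toLp 2 ⁻¹' A + ∑ i : Fin n, axisSegment i ε) \ (WithLp.toLp 2 ⁻¹' A) := by
  rintro v ⟨⟨a, ha, _, ⟨b, hb, rfl⟩, hv⟩, hvA⟩
  -- The vector `ε b` is split into its coordinate components, each bounded by `ε` because `|b i| ≤
  -- ‖b‖ ≤ 1`.
  refine ⟨⟨WithLp.ofLp a, ha, ∑ i, Pi.single i (ε * b i), ?_, ?_⟩, hvA⟩
  · refine Set.finsetSum_mem_finsetSum _ _ _ fun i _ => ⟨ε * b i, ?_, rfl⟩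
    have hbi : |b i| ≤ 1 := (PiLp.norm_apply_le b i).trans (mem_closedBall_zero_iff.1 hb)
    rw [Set.mem_Icc, ← abs_le, abs_mul, abs_of_nonneg hε]
    exact mul_le_of_le_one_right hε hbi
  · rw [Finset.univ_sum_single (fun i => ε * b i)]
    exact congrArg WithLp.ofLp hv

lemma measure_outerLayer_le [IsProbabilityMeasure μ] (hlc : IsLogConcave μ) (hiso : IsIsotropic μ)
    (hf : IsDensity μ f) (hcont : Continuous f) (hunc : IsUnconditional f)
    {A : Set (EuclideanSpace ℝ (Fin n))} (hA : Convex ℝ A) {ε : ℝ} (hε : 0 < ε) :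
    μ (outerLayer A ε) ≤ ENNReal.ofReal (√2 * n * ε) := by
  obtain ⟨g, hg, hglc⟩ := hlc
  have hflc := isLogConcaveMap_of_ae_eq hcont hglc (hf.ae_eq hg)
  have h1 : ∫⁻ x : Fin n → ℝ, ENNReal.ofReal (f (WithLp.toLp 2 x)) = 1 := by
    rw [← hf.lintegral_eq_one]
    exact (PiLp.volume_preserving_toLp (Fin n)).lintegral_comp_emb
      (MeasurableEquiv.toLp 2 (Fin n → ℝ)).measurableEmbedding fun x => ENNReal.ofReal (f x)
  have hA' : Convex ℝ (WithLp.toLp 2 ⁻¹' A : Set (Fin n → ℝ)) :=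
    hA.linear_preimage (WithLp.linearEquiv 2 ℝ (Fin n → ℝ)).symm.toLinearMap
  rw [hf.apply_eq]
  refine (measure_mono (preimage_outerLayer_subset A hε.le)).trans
    ((measure_add_sum_sdiff_le (fun i => convex_axisSegment i ε) (fun i B hB =>
      measure_add_axisSegment_sdiff_le hcont hf.nonneg hflc hunc h1 i (hiso.one_le_lintegral hf i)
        hB hε.le) Finset.univ hA').trans_eq ?_)
  rw [Finset.card_univ, Fintype.card_fin, ← ENNReal.ofReal_natCast,
    ← ENNReal.ofReal_mul (Nat.cast_nonneg n)]
  congr 1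
  ring

lemma perimeter_le_of_measure_outerLayer_le {A : Set (EuclideanSpace ℝ (Fin n))} {c : ℝ}
    (h : ∀ ε : ℝ, 0 < ε → μ (outerLayer A ε) ≤ ENNReal.ofReal (c * ε)) :
    perimeter μ A ≤ ENNReal.ofReal c := by
  refine liminf_le_of_frequently_le' (Eventually.frequently ?_)
  filter_upwards [self_mem_nhdsWithin] with ε hε
  rw [Set.mem_Ioi] at hε
  refine ENNReal.div_le_of_le_mul ((h ε hε).trans_eq ?_)
  rw [ENNReal.ofReal_mul' hε.le]

end

end MaxPerimeter

theorem mainTheorem4 (n : ℕ) (μ : Measure (EuclideanSpace ℝ (Fin n))) [IsProbabilityMeasure μ]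
    (hlc : MaxPerimeter.IsLogConcave μ) (hiso : MaxPerimeter.IsIsotropic μ)
    (f : EuclideanSpace ℝ (Fin n) → ℝ) (hf : MaxPerimeter.IsDensity μ f) (hcont : Continuous f)
    (hunc : MaxPerimeter.IsUnconditional f) :
    (∀ A : Set (EuclideanSpace ℝ (Fin n)), Convex ℝ A → ∀ ε : ℝ, 0 < ε →
      μ (MaxPerimeter.outerLayer A ε) ≤ ENNReal.ofReal (√2 * n * ε)) ∧
    (∀ A : Set (EuclideanSpace ℝ (Fin n)), Convex ℝ A →
      MaxPerimeter.perimeter μ A ≤ ENNReal.ofReal (√2 * n)) ∧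
    MaxPerimeter.maximalPerimeter μ ≤ ENNReal.ofReal (√2 * n) := by
  have h1 : ∀ A : Set (EuclideanSpace ℝ (Fin n)), Convex ℝ A → ∀ ε : ℝ, 0 < ε →
      μ (MaxPerimeter.outerLayer A ε) ≤ ENNReal.ofReal (√2 * n * ε) := fun A hA ε hε =>
    MaxPerimeter.measure_outerLayer_le hlc hiso hf hcont hunc hA hε
  have h2 : ∀ A : Set (EuclideanSpace ℝ (Fin n)), Convex ℝ A →
      MaxPerimeter.perimeter μ A ≤ ENNReal.ofReal (√2 * n) := fun A hA =>
    MaxPerimeter.perimeter_le_of_measure_outerLayer_le (h1 A hA)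
  exact ⟨h1, h2, iSup₂_le fun A hA => h2 A hA.convex⟩
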